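/- **Setting.** Let $\mathcal G=(\mathcal V,\mathcal E)$ be a directed acyclic graph with finitely many edges, $\mathcal S$ a finite set of sources, and $a(s),b(s)\subseteq\mathcal V$ with $a(s)\cap b(s)=\emptyset$ the sets of nodes at which source $s$ is available, respectively demanded. For an edge $e=(u,v)$ write $s\to e$ if $u\in a(s)$, $f\to e$ if the edge $f$ ends at $u$, and $e\to w$ if $w=v$. The sources $(Y_s)_{s\in\mathcal S}$ have finite alphabets $\mathcal Y_s$ and an arbitrary joint law; $(Y_s^n)_{s\in\mathcal S}$, $n=1,2,\dots$, are i.i.d. copies, and $Y_s^{(N)}=(Y_s^1,\dots,Y_s^N)$. Logarithms are to base 2. *Achievable region.* A network code of block length $N$ consists of finite message alphabets $\mathcal U_e^{(N)}$, functions giving the message $U_e^{(N)}\in\mathcal U_e^{(N)}$ on each edge $e$ from $(Y_s^{(N)}: s\to e)$ and $(U_f^{(N)}: f\to e)$, and, for $s\in\mathcal S$ and $u\in b(s)$, a decoding function giving an estimate in $\mathcal Y_s^{N}$ of $Y_s^{(N)}$ from $(Y_{s'}^{(N)}: u\in a(s'))$ and $(U_f^{(N)}: f\to u)$. $\mathcal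 R_{\rm cs}$ is the set of all $\mathbf C=(C_e)_{e\in\mathcal E}$ for which there are network codes, one for each $N$, such that $\lim_{N\to\infty}\frac1N\log|\mathcal U_e^{(N)}|\le C_e$ for all $e$ and, for all $s\in\mathcal S$, $u\in b(s)$, the probability that the estimate of $Y_s^{(N)}$ at $u$ is wrong tends to $0$ as $N\to\infty$. *Outer bounds.* For a finite set $\mathcal Z$, let $\Gamma=\Gamma(\mathcal Z)$ be the set of polymatroids, i.e. functions $h:2^{\mathcal Z}\to[0,\infty)$ with $h(\emptyset)=0$ that are nondecreasing and submodular; let $\Gamma^*$ be the set of entropy functions $\alpha\mapsto H(X_z,z\in\alpha)$ of families $(X_z)_{z\in\mathcal Z}$ of discrete random variables with finite joint entropy; and let $\overline{\Gamma^*}$ be its closure. Write $h(\alpha|\beta)=h(\alpha\cup\beta)-h(\beta)$. For a set $\Delta$ of functions on the subsets of $\mathcal S\cup\mathcal E$, $\mathcal R_{\rm cs}(\Delta)$ is the set of all $\mathbf C$ for which some $h\in\Delta$ satisfies $$h(\alpha)=H(Y_s,s\in\alpha)\qquad(\alpha\subseteq\mathcal S)$$ and $$h(e\,|\,f\in\mathcal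 S\cup\mathcal E: f\to e)=0,\qquad h(s\,|\,s'\in\mathcal S: u\in a(s'),\ f\in\mathcal E: f\to u)=0,\qquad h(e)\le C_e\qquad(\ast)$$ for all $e\in\mathcal E$, $s\in\mathcal S$, $u\in b(s)$. *Improved outer bounds.* Let $(K_i)_{i\in\mathcal L}$, with $\mathcal L$ finite, be discrete auxiliary random variables given by any fixed conditional law $P_{K_{\mathcal L}|Y_{\mathcal S}}$ such that the joint entropy of $(Y_{\mathcal S},K_{\mathcal L})$ is finite. For a set $\Delta^*$ of functions on the subsets of $\mathcal S\cup\mathcal E\cup\mathcal L$ (a disjoint union), $\mathcal R^*_{\rm cs}(\Delta^*)$ is the set of all $\mathbf C$ for which some $h\in\Delta^*$ satisfies $(\ast)$ and $$h(\alpha\cup\beta)=H(Y_s,s\in\alpha,\ K_i,i\in\beta)\qquad(\alpha\subseteq\mathcal S,\ \beta\subseteq\mathcal L).$$ In $\mathcal R_{\rm cs}(\cdot)$ the sets $\Gamma,\overline{\Gamma^*}$ are taken over $\mathcal S\cup\mathcal E$, in $\mathcal R^*_{\rm cs}(\cdot)$ over $\mathcal S\cup\mathcal E\cup\mathcal L$.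 **Theorem (Improved outer bounds).** For every such network, sources and auxiliary random variables, $$\mathcal R_{\rm cs}\subseteq\mathcal R^*_{\rm cs}(\overline{\Gamma^*})\subseteq\mathcal R_{\rm cs}(\overline{\Gamma^*})\subseteq\mathcal R_{\rm cs}(\Gamma)\qquad\text{and}\qquad\mathcal R_{\rm cs}\subseteq\mathcal R^*_{\rm cs}(\Gamma)\subseteq\mathcal R_{\rm cs}(\Gamma).$$ -/

import Mathlib

open Filter Topology
open scoped ENNReal

noncomputable section

/-! ## Entropy of discrete random variables -/

/-- Shannon entropy (in bits) of a discrete probability law. It is meaningful for laws that satisfy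
`HasFiniteEntropy`, in particular for every law on a finite alphabet. -/
def entropy {A : Type*} (p : PMF A) : ℝ :=
  ∑' a, Real.negMulLog (p a).toReal / Real.log 2

/-- The entropy series converges, that is, the entropy is finite (its terms are nonnegative). -/
def HasFiniteEntropy {A : Type*} (p : PMF A) : Prop :=
  Summable fun a => Real.negMulLog (p a).toReal

/-- The entropy function `α ↦ H(X_z, z ∈ α)` of a family `(X_z)` of discrete random variables with
joint law `p`. -/
def entropyFunction {Z : Type*} {X : Z → Type*} (p : PMF (∀ z, X z)) (α : Set Z) : ℝ :=
  entropy (p.map α.domRestrict)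

/-! ## Polymatroids and (almost) entropic functions -/

/-- Polymatroids on the ground set `Z`. -/
structure IsPolymatroid {Z : Type*} (h : Set Z → ℝ) : Prop where
  empty : h ∅ = 0
  nonneg : ∀ α, 0 ≤ h α
  mono : ∀ α β, β ⊆ α → h β ≤ h α
  submodular : ∀ α β, h (α ∩ β) + h (α ∪ β) ≤ h α + h β

/-- `Γ`: the set of all polymatroids on `Z`. -/
def polymatroids (Z : Type*) : Set (Set Z → ℝ) := {h | IsPolymatroid h}

/-- `Γ*`: the set of all entropy functions of families, indexed by `Z`, of discrete random variables
with finite joint entropy. -/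
def entropicFunctions (Z : Type*) : Set (Set Z → ℝ) :=
  {h | ∃ (X : Z → Type) (p : PMF (∀ z, X z)), HasFiniteEntropy p ∧ h = entropyFunction p}

/-- The closure of `Γ*`: the set of all almost entropic functions. -/
def almostEntropicFunctions (Z : Type*) : Set (Set Z → ℝ) := closure (entropicFunctions Z)

/-- `h(α | β) = h(α ∪ β) - h(β)`. -/
def condVal {Z : Type*} (h : Set Z → ℝ) (α β : Set Z) : ℝ := h (α ∪ β) - h β

/-! ## Networks and network codes -/

/-- A directed acyclic network with nodes `V`, edges `E` and sources `S`; the edge `e` goes from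
`tail e` to `head e`, the source `s` is available at the nodes of `avail s` and is demanded by the
nodes of `demand s`. -/
structure Network (V E S : Type*) where
  tail : E → V
  head : E → V
  acyclic : ∀ v, ¬ Relation.TransGen (fun u w => ∃ e, tail e = u ∧ head e = w) v v
  avail : S → Set V
  demand : S → Set V
  disjoint : ∀ s, Disjoint (avail s) (demand s)

namespace Network

variable {V E S : Type*} (net : Network V E S)

/-- The sources and edges that are available at the node `u`: all `s` with `u ∈ avail s` and all `f`
with `f → u`. -/
def incoming (u : V) : Set (S ⊕ E) :=
  Sum.inl '' {s | u ∈ net.avail s} ∪ Sum.inr '' {f | net.head f = u}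

theorem wellFounded_feeds [Finite E] : WellFounded fun f e : E => net.head f = net.tail e := by
  let r : E → E → Prop := fun f e => net.head f = net.tail e
  have hirr : ∀ e, ¬ Relation.TransGen r e e := fun e he =>
    net.acyclic (net.tail e) (he.lift net.tail fun f _ hfg => ⟨f, rfl, hfg⟩)
  have : Std.Irrefl (Relation.TransGen r) := ⟨hirr⟩
  have hwf : WellFounded (Relation.TransGen r) := Finite.wellFounded_of_trans_of_irrefl _
  exact Subrelation.wf (r := Relation.TransGen r) (fun {a b} (h : r a b) => .single h) hwf

end Network

/-- A network code over blocks of `N` source symbols. The message alphabet of the edge `e` is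
`Fin (size e)`, and `Y s` is the alphabet of the source `s`. -/
structure NetworkCode {V E S : Type*} (net : Network V E S) (Y : S → Type*) (N : ℕ) where
  size : E → ℕ
  encode : ∀ e : E, (∀ s : {s // net.tail e ∈ net.avail s}, Fin N → Y s) →
    (∀ f : {f // net.head f = net.tail e}, Fin (size f)) → Fin (size e)
  decode : ∀ (s : S) (u : V), u ∈ net.demand s →
    (∀ s' : {s' // u ∈ net.avail s'}, Fin N → Y s') →
    (∀ f : {f // net.head f = u}, Fin (size f)) → (Fin N → Y s)

namespace NetworkCode

variable {V E S : Type*} {net : Network V E S} {Y : S → Type*} {N : ℕ}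

/-- The messages on the edges when the block of source symbols is `y` (`y n s` is the `n`-th symbol
of the source `s`), computed along the acyclic network. -/
def message [Finite E] (c : NetworkCode net Y N) (y : Fin N → ∀ s, Y s) (e : E) : Fin (c.size e) :=
  net.wellFounded_feeds.fix
    (fun e ih => c.encode e (fun s n => y n s) fun f => ih f f.2) e

theorem message_eq [Finite E] (c : NetworkCode net Y N) (y : Fin N → ∀ s, Y s) (e : E) :
    c.message y e = c.encode e (fun s n => y n s) fun f => c.message y f :=
  net.wellFounded_feeds.fix_eq _ e

/-- The block of symbols of the source `s` that the node `u` reconstructs. -/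
def decoded [Finite E] (c : NetworkCode net Y N) (s : S) (u : V) (hu : u ∈ net.demand s)
    (y : Fin N → ∀ s, Y s) : Fin N → Y s :=
  c.decode s u hu (fun s' n => y n s') fun f => c.message y f

/-- The probability that the node `u` does not reconstruct the source `s` correctly when the source
symbols of the block are independent in time, with joint law `p` at each time. -/
def errorProb [Finite E] (p : PMF (∀ s, Y s)) (c : NetworkCode net Y N) (s : S) (u : V)
    (hu : u ∈ net.demand s) : ℝ≥0∞ :=
  ∑' y : Fin N → ∀ s, Y s,
    Set.indicator {y | c.decoded s u hu y ≠ fun n => y n s} (fun y => ∏ n, p (y n)) y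

end NetworkCode

/-! ## The achievable region and its outer bounds -/

section Regions

variable {V E S L : Type*} (net : Network V E S) {Y : S → Type*} (p : PMF (∀ s, Y s))
  {K : L → Type*}

/-- The link capacity tuple `C` is achievable for the sources with joint law `p`. -/
def IsAchievable [Finite E] (C : E → ℝ) : Prop :=
  ∃ c : ∀ N : ℕ, NetworkCode net Y N,
    (∀ e, ∃ l ≤ C e, Tendsto (fun N : ℕ => Real.logb 2 ((c N).size e) / N) atTop (𝓝 l)) ∧
    ∀ (s : S) (u : V) (hu : u ∈ net.demand s),
      Tendsto (fun N : ℕ => (c N).errorProb p s u hu) atTop (𝓝 0)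

/-- The set of all achievable link capacity tuples. -/
def achievableRegion [Finite E] : Set (E → ℝ) := {C | IsAchievable net p C}

/-- The constraints that the network and the link capacities put on `h`: the message on an edge is
determined by what enters its tail, a demanded source by what enters the node that demands it, and
the message on `e` has entropy at most `C e`. -/
structure NetworkConstraints (C : E → ℝ) (h : Set (S ⊕ E) → ℝ) : Prop where
  encode : ∀ e, condVal h {Sum.inr e} (net.incoming (net.tail e)) = 0
  decode : ∀ s, ∀ u ∈ net.demand s, condVal h {Sum.inl s} (net.incoming u) = 0
  capacity : ∀ e, h {Sum.inr e} ≤ C e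

/-- The region `R_cs(Δ)`. -/
def outerRegion (Δ : Set (Set (S ⊕ E) → ℝ)) : Set (E → ℝ) :=
  {C | ∃ h ∈ Δ, (∀ α : Set S, h (Sum.inl '' α) = entropyFunction p α) ∧
    NetworkConstraints net C h}

/-- The joint law of the sources, with law `p`, and of auxiliary random variables with conditional
law `κ` given the sources. -/
def jointLaw (κ : (∀ s, Y s) → PMF (∀ i, K i)) : PMF ((∀ s, Y s) × (∀ i, K i)) :=
  p.bind fun y => (κ y).map fun k => (y, k)

/-- The joint entropy `H(Y_s, s ∈ α, K_i, i ∈ β)`. -/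
def jointEntropy (κ : (∀ s, Y s) → PMF (∀ i, K i)) (α : Set S) (β : Set L) : ℝ :=
  entropy ((jointLaw p κ).map fun x => (α.domRestrict x.1, β.domRestrict x.2))

/-- The region `R*_cs(Δ)`, for functions on the subsets of `S ∪ E ∪ L`. -/
def improvedOuterRegion (κ : (∀ s, Y s) → PMF (∀ i, K i)) (Δ : Set (Set ((S ⊕ E) ⊕ L) → ℝ)) :
    Set (E → ℝ) :=
  {C | ∃ h ∈ Δ,
    (∀ (α : Set S) (β : Set L),
      h (Sum.inl '' (Sum.inl '' α) ∪ Sum.inr '' β) = jointEntropy p κ α β) ∧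
    NetworkConstraints net C fun γ => h (Sum.inl '' γ)}

end Regions

end

-- The substantial inclusion is that of the achievable region in the improved region for almost
-- entropic functions. Given codes of block length `N`, extend the i.i.d. sources by i.i.d. copies
-- of the auxiliary variables and take the joint entropy function of source blocks, messages and
-- auxiliary blocks, divided by `N`. On sources and auxiliaries it equals the prescribed joint
-- entropy exactly (`codeEntropy_sources`); the encoding constraints hold exactly
-- (`codeEntropy_encode`); the decoding constraints hold up to a Fano term that vanishes with the
-- error probability (`codeEntropy_decode`); messages obey the cardinality bound
-- (`codeEntropy_message_le`). These functions are bounded, so a limit point exists and satisfies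
-- all constraints.
--
-- An entropy function scaled by `1 / N` need not be entropic. Revealing the whole family with
-- probability `1 / N`, and a constant otherwise, produces an entropic function that differs from
-- the scaled one by at most a binary entropy tending to `0`; hence the limit is almost entropic
-- (`exists_tendsto_scaled_familyEntropy`).
--
-- The other inclusions are formal: polymatroids form a closed set containing the entropic
-- functions, and restriction from `(S ⊕ E) ⊕ L` to `S ⊕ E` preserves both classes. Submodularity,
-- the cardinality bound and Fano's inequality are all instances of one Gibbs inequality,
-- `eEntropy_map_prod_add_le`. Entropies take values in `ℝ≥0∞`, so that sums need no convergence
-- argument.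

universe u₁ u₂ u₃ u₄

noncomputable section

/-! ## Entropy in `ℝ≥0∞` -/

namespace PMF

variable {Ω : Type u₁} {A : Type u₂} {B : Type u₃} {D : Type u₄}

/-- The self-information (in nats) of the outcome `a`. -/
def info (p : PMF A) (a : A) : ℝ := -Real.log (p a).toReal

theorem toReal_le_one (p : PMF A) (a : A) : (p a).toReal ≤ 1 := by
  have := ENNReal.toReal_mono ENNReal.one_ne_top (p.coe_le_one a)
  simpa using this

theorem info_nonneg (p : PMF A) (a : A) : 0 ≤ p.info a :=
  neg_nonneg.2 (Real.log_nonpos ENNReal.toReal_nonneg (p.toReal_le_one a))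

theorem toReal_pos {p : PMF A} {a : A} (h : p a ≠ 0) : 0 < (p a).toReal :=
  ENNReal.toReal_pos h (p.apply_ne_top a)

theorem exp_info {p : PMF A} {a : A} (h : p a ≠ 0) : Real.exp (p.info a) = (p a).toReal⁻¹ := by
  rw [info, Real.exp_neg, Real.exp_log (toReal_pos h)]

/-- The expectation of a function with values in `ℝ≥0∞`. -/
def expect (p : PMF A) (g : A → ℝ≥0∞) : ℝ≥0∞ := ∑' a, p a * g a

/-- Shannon entropy in nats, with values in `ℝ≥0∞`. -/
def eEntropy (p : PMF A) : ℝ≥0∞ := p.expect fun a => ENNReal.ofReal (p.info a)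

theorem expect_mono (p : PMF A) {g g' : A → ℝ≥0∞} (h : ∀ a, p a ≠ 0 → g a ≤ g' a) :
    p.expect g ≤ p.expect g' := by
  refine ENNReal.tsum_le_tsum fun a => ?_
  rcases eq_or_ne (p a) 0 with h0 | h0
  · simp [h0]
  · gcongr; exact h a h0

theorem expect_congr (p : PMF A) {g g' : A → ℝ≥0∞} (h : ∀ a, p a ≠ 0 → g a = g' a) :
    p.expect g = p.expect g' :=
  le_antisymm (p.expect_mono fun a ha => (h a ha).le) (p.expect_mono fun a ha => (h a ha).ge)

theorem expect_add (p : PMF A) (g g' : A → ℝ≥0∞) :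
    p.expect (fun a => g a + g' a) = p.expect g + p.expect g' := by
  simp only [expect, mul_add, ENNReal.tsum_add]

theorem expect_const (p : PMF A) (c : ℝ≥0∞) : p.expect (fun _ => c) = c := by
  simp only [expect, ENNReal.tsum_mul_right, p.tsum_coe, one_mul]

theorem expect_map (p : PMF Ω) (f : Ω → A) (g : A → ℝ≥0∞) :
    (p.map f).expect g = p.expect fun ω => g (f ω) := by
  simp only [expect, PMF.map_apply, ← ENNReal.tsum_mul_right]
  rw [ENNReal.tsum_comm]
  refine tsum_congr fun ω => ?_
  rw [tsum_eq_single (f ω)]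
  · simp
  · intro a ha; simp [ha]

theorem le_map_apply (p : PMF Ω) (f : Ω → A) (ω : Ω) : p ω ≤ p.map f (f ω) := by
  rw [PMF.map_apply]
  refine le_trans ?_ (ENNReal.le_tsum ω)
  simp

theorem map_apply_ne_zero {p : PMF Ω} {ω : Ω} (h : p ω ≠ 0) (f : Ω → A) : p.map f (f ω) ≠ 0 :=
  fun h0 => h (le_antisymm (h0 ▸ p.le_map_apply f ω) bot_le)

theorem eEntropy_map (p : PMF Ω) (f : Ω → A) :
    (p.map f).eEntropy = p.expect fun ω => ENNReal.ofReal ((p.map f).info (f ω)) :=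
  p.expect_map f _

/-- A random variable `f` that is determined by `g` has at most the entropy of `g`. -/
theorem eEntropy_map_le_of_determined (p : PMF Ω) (f : Ω → A) (g : Ω → B)
    (h : ∀ ω ω', p ω ≠ 0 → p ω' ≠ 0 → g ω' = g ω → f ω' = f ω) :
    (p.map f).eEntropy ≤ (p.map g).eEntropy := by
  rw [eEntropy_map, eEntropy_map]
  refine p.expect_mono fun ω hω => ENNReal.ofReal_le_ofReal ?_
  -- The comparison is pointwise: up to null outcomes the fibre of `g` through `ω` lies in the fibre
  -- of `f`, so the value of `f` is at least as probable as that of `g`.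
  refine neg_le_neg (Real.log_le_log (toReal_pos (map_apply_ne_zero hω g)) ?_)
  refine ENNReal.toReal_mono (apply_ne_top _ _) ?_
  rw [PMF.map_apply, PMF.map_apply]
  refine ENNReal.tsum_le_tsum fun ω' => ?_
  split_ifs with h1 h2 h2
  · exact le_rfl
  · rcases eq_or_ne (p ω') 0 with h0 | h0
    · simp [h0]
    · exact absurd (h ω ω' hω h0 h1.symm).symm h2
  · exact bot_le
  · exact le_rfl

theorem eEntropy_map_eq_of_determined (p : PMF Ω) (f : Ω → A) (g : Ω → B)
    (h : ∀ ω ω', p ω ≠ 0 → p ω' ≠ 0 → (g ω' = g ω ↔ f ω' = f ω)) :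
    (p.map f).eEntropy = (p.map g).eEntropy :=
  le_antisymm (p.eEntropy_map_le_of_determined f g fun ω ω' hω hω' => (h ω ω' hω hω').1)
    (p.eEntropy_map_le_of_determined g f fun ω ω' hω hω' => (h ω ω' hω hω').2)

theorem eEntropy_map_le (p : PMF Ω) (f : Ω → A) : (p.map f).eEntropy ≤ p.eEntropy := by
  have := p.eEntropy_map_le_of_determined f id fun ω ω' _ _ h => congrArg f h
  rwa [PMF.map_id] at this

theorem eEntropy_map_of_injective (p : PMF Ω) {f : Ω → A} (hf : Function.Injective f) :
    (p.map f).eEntropy = p.eEntropy := by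
  have := p.eEntropy_map_eq_of_determined f id fun ω ω' _ _ => hf.eq_iff.symm
  rwa [PMF.map_id] at this

theorem eEntropy_of_subsingleton [Subsingleton A] (p : PMF A) : p.eEntropy = 0 := by
  have h1 : ∀ a, p a = 1 := fun a => by
    rw [← p.tsum_coe, tsum_eq_single a fun b hb => absurd (Subsingleton.elim b a) hb]
  simp [eEntropy, expect, info, h1]

/-- From `1 + t ≤ exp t` with `t = b - a` one gets `b + 1 ≤ a + exp (b - a)`. After taking
expectations only the finite constant `1` is cancelled, so infinite expectations are harmless. -/
theorem expect_le_of_expect_exp_le (p : PMF Ω) (a b : Ω → ℝ) (hb : ∀ ω, 0 ≤ b ω)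
    (ha : ∀ ω, 0 ≤ a ω)
    (h : p.expect (fun ω => ENNReal.ofReal (Real.exp (b ω - a ω))) ≤ 1) :
    p.expect (fun ω => ENNReal.ofReal (b ω)) ≤ p.expect fun ω => ENNReal.ofReal (a ω) := by
  have key : p.expect (fun ω => ENNReal.ofReal (b ω)) + 1 ≤
      p.expect (fun ω => ENNReal.ofReal (a ω)) + 1 := by
    calc p.expect (fun ω => ENNReal.ofReal (b ω)) + 1
        = p.expect (fun ω => ENNReal.ofReal (b ω) + 1) := by rw [expect_add, expect_const]
      _ ≤ p.expect (fun ω => ENNReal.ofReal (a ω) + ENNReal.ofReal (Real.exp (b ω - a ω))) := by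
          refine p.expect_mono fun ω _ => ?_
          rw [← ENNReal.ofReal_add (ha ω) (Real.exp_pos _).le]
          rw [← ENNReal.ofReal_one, ← ENNReal.ofReal_add (hb ω) zero_le_one]
          exact ENNReal.ofReal_le_ofReal (by linarith [Real.add_one_le_exp (b ω - a ω)])
      _ ≤ _ := by rw [expect_add]; gcongr
  exact (ENNReal.add_le_add_iff_right ENNReal.one_ne_top).1 key

/-- Gibbs' inequality for the conditional law of `X` given `Z`. -/
theorem eEntropy_map_prod_add_le (p : PMF Ω) (X : Ω → A) (Z : Ω → B) (u v : Ω → ℝ)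
    (hu : ∀ ω, 0 ≤ u ω) (hv : ∀ ω, 0 ≤ v ω) (w : A → B → ℝ≥0∞) (hw : ∀ z, ∑' x, w x z ≤ 1)
    (huv : ∀ ω, p ω ≠ 0 → ENNReal.ofReal (Real.exp (u ω - v ω)) ≤ w (X ω) (Z ω)) :
    (p.map fun ω => (X ω, Z ω)).eEntropy + p.expect (fun ω => ENNReal.ofReal (u ω)) ≤
      (p.map Z).eEntropy + p.expect fun ω => ENNReal.ofReal (v ω) := by
  set m : Ω → A × B := fun ω => (X ω, Z ω) with hm
  rw [eEntropy_map, eEntropy_map, ← expect_add, ← expect_add]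
  have e1 : ∀ ω, ENNReal.ofReal ((p.map m).info (m ω)) + ENNReal.ofReal (u ω) =
      ENNReal.ofReal ((p.map m).info (m ω) + u ω) := fun ω =>
    (ENNReal.ofReal_add (info_nonneg _ _) (hu ω)).symm
  have e2 : ∀ ω, ENNReal.ofReal ((p.map Z).info (Z ω)) + ENNReal.ofReal (v ω) =
      ENNReal.ofReal ((p.map Z).info (Z ω) + v ω) := fun ω =>
    (ENNReal.ofReal_add (info_nonneg _ _) (hv ω)).symm
  simp only [e1, e2]
  refine p.expect_le_of_expect_exp_le _ _
    (fun ω => add_nonneg (info_nonneg _ _) (hu ω)) (fun ω => add_nonneg (info_nonneg _ _) (hv ω)) ?_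
  -- The exponential contains the inverse probability of `(X, Z)`, which cancels the joint law. What
  -- remains is at most the total mass of the law of `Z` times the subprobability kernel `w`.
  calc p.expect (fun ω => ENNReal.ofReal
        (Real.exp ((p.map m).info (m ω) + u ω - ((p.map Z).info (Z ω) + v ω))))
      ≤ p.expect (fun ω => (p.map m (m ω))⁻¹ * (p.map Z (Z ω) * w (X ω) (Z ω))) := by
        refine p.expect_mono fun ω hω => ?_
        have hm0 := map_apply_ne_zero hω m
        have hZ0 := map_apply_ne_zero hω Z
        have : (p.map m).info (m ω) + u ω - ((p.map Z).info (Z ω) + v ω) =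
          (p.map m).info (m ω) + (-(p.map Z).info (Z ω) + (u ω - v ω)) := by ring
        rw [this, Real.exp_add, Real.exp_add, exp_info hm0, Real.exp_neg, exp_info hZ0, inv_inv,
          ENNReal.ofReal_mul (by positivity), ENNReal.ofReal_mul (by positivity),
          ENNReal.ofReal_inv_of_pos (toReal_pos hm0), ENNReal.ofReal_toReal (apply_ne_top _ _),
          ENNReal.ofReal_toReal (apply_ne_top _ _)]
        gcongr
        exact huv ω hω
    _ = (p.map m).expect (fun x => (p.map m x)⁻¹ * (p.map Z x.2 * w x.1 x.2)) := by
        rw [expect_map]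
    _ ≤ ∑' x : A × B, p.map Z x.2 * w x.1 x.2 := by
        refine ENNReal.tsum_le_tsum fun x => ?_
        rw [← mul_assoc]
        exact mul_le_of_le_one_left bot_le (ENNReal.mul_inv_le_one _)
    _ = ∑' z, p.map Z z * ∑' x, w x z := by
        rw [ENNReal.tsum_prod (f := fun x z => p.map Z z * w x z), ENNReal.tsum_comm]
        simp only [ENNReal.tsum_mul_left]
    _ ≤ ∑' z, p.map Z z := ENNReal.tsum_le_tsum fun z => mul_le_of_le_one_right bot_le (hw z)
    _ = 1 := PMF.tsum_coe _

/-- Submodularity of entropy: `H(f, g) + H(k) ≤ H(f) + H(g)` if `k` is a function of `f` and a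
function of `g`. -/
theorem eEntropy_submodular (p : PMF Ω) (f : Ω → A) (g : Ω → B) (φ : A → D) (ψ : B → D)
    (h : ∀ ω, ψ (g ω) = φ (f ω)) :
    (p.map fun ω => (g ω, f ω)).eEntropy + (p.map fun ω => φ (f ω)).eEntropy ≤
      (p.map f).eEntropy + (p.map g).eEntropy := by
  classical
  set k : Ω → D := fun ω => φ (f ω) with hk
  have hkg : p.map k = (p.map g).map ψ := by
    rw [PMF.map_comp]; congr 1; funext ω; exact (h ω).symm
  rw [p.eEntropy_map k, p.eEntropy_map g]
  -- The kernel is the conditional law of `g` given `k`, evaluated at `k = φ a`. Gibbs' inequality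
  -- thus compares the true law of `g` given `f` with the one that would make `f` and `g`
  -- independent given `k`.
  refine p.eEntropy_map_prod_add_le g f _ _ (fun _ => info_nonneg _ _) (fun _ => info_nonneg _ _)
    (fun b a => (if φ a = ψ b then p.map g b else 0) * (p.map k (φ a))⁻¹) (fun a => ?_)
    (fun ω hω => ?_)
  · rw [ENNReal.tsum_mul_right, ← PMF.map_apply, hkg]
    exact ENNReal.mul_inv_le_one _
  · have hg0 := map_apply_ne_zero hω g
    have hk0 := map_apply_ne_zero hω k
    rw [if_pos (h ω).symm, sub_eq_add_neg, Real.exp_add, Real.exp_neg, exp_info hg0, inv_inv,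
      exp_info hk0, ENNReal.ofReal_mul (by positivity),
      ENNReal.ofReal_inv_of_pos (toReal_pos hk0), ENNReal.ofReal_toReal (apply_ne_top _ _),
      ENNReal.ofReal_toReal (apply_ne_top _ _), mul_comm]

theorem one_le_natCard [Finite A] (a : A) : (1 : ℝ) ≤ Nat.card A := by
  have : Nonempty A := ⟨a⟩
  exact_mod_cast Nat.card_pos (α := A)

theorem tsum_const_inv_natCard_le [Finite A] :
    ∑' _ : A, ((Nat.card A : ℝ≥0∞))⁻¹ ≤ 1 := by
  have := Fintype.ofFinite A
  rw [tsum_fintype, Finset.sum_const, nsmul_eq_mul, Nat.card_eq_fintype_card, Finset.card_univ]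
  exact ENNReal.mul_inv_le_one _

/-- Gibbs' inequality against the uniform law, with a trivial conditioning variable. -/
theorem eEntropy_le_log_card [Finite A] (p : PMF A) :
    p.eEntropy ≤ ENNReal.ofReal (Real.log (Nat.card A)) := by
  obtain ⟨a₀, -⟩ := p.support_nonempty
  have h1 := one_le_natCard a₀
  have := p.eEntropy_map_prod_add_le id (fun _ => ()) (fun _ => 0)
    (fun _ => Real.log (Nat.card A)) (fun _ => le_rfl) (fun _ => Real.log_nonneg h1)
    (fun _ _ => (Nat.card A : ℝ≥0∞)⁻¹) (fun _ => tsum_const_inv_natCard_le) (fun ω _ => by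
      rw [zero_sub, Real.exp_neg, Real.exp_log (by linarith),
        ENNReal.ofReal_inv_of_pos (by linarith), ENNReal.ofReal_natCast])
  simp only [ENNReal.ofReal_zero, expect_const, add_zero, eEntropy_of_subsingleton, zero_add] at this
  rwa [p.eEntropy_map_of_injective fun x y hxy => congrArg Prod.fst hxy] at this

/-- A form of Fano's inequality. -/
theorem eEntropy_fano [Finite A] (p : PMF Ω) (X : Ω → A) (Z : Ω → B) (d : B → A) :
    (p.map fun ω => (X ω, Z ω)).eEntropy ≤ (p.map Z).eEntropy + (ENNReal.ofReal (Real.log 2) +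
      p.expect ({ω | d (Z ω) ≠ X ω}.indicator 1) * ENNReal.ofReal (Real.log (Nat.card A))) := by
  classical
  obtain ⟨ω₀, -⟩ := p.support_nonempty
  have h1 := one_le_natCard (X ω₀)
  have hl : 0 ≤ Real.log (Nat.card A) := Real.log_nonneg h1
  have hl2 : 0 ≤ Real.log 2 := Real.log_nonneg one_le_two
  -- The comparison kernel is an even mixture of the point mass at the guess `d z` and the uniform
  -- law. The weight `1 / 2` costs `log 2` always; the uniform part costs `log (Nat.card A)` only
  -- when the guess is wrong.
  have key := p.eEntropy_map_prod_add_le X Z (fun _ => 0)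
    (fun ω => Real.log 2 + if d (Z ω) ≠ X ω then Real.log (Nat.card A) else 0) (fun _ => le_rfl)
    (fun ω => by split_ifs <;> positivity)
    (fun x z => 2⁻¹ * (if x = d z then 1 else 0) + 2⁻¹ * (Nat.card A : ℝ≥0∞)⁻¹)
    (fun z => by
      rw [ENNReal.tsum_add, ENNReal.tsum_mul_left, ENNReal.tsum_mul_left, tsum_ite_eq]
      calc _ ≤ (2⁻¹ : ℝ≥0∞) * 1 + 2⁻¹ * 1 := by gcongr; exact tsum_const_inv_natCard_le
        _ = 1 := by rw [mul_one, ENNReal.inv_two_add_inv_two])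
    (fun ω _ => by
      have e2 : ENNReal.ofReal 2⁻¹ = 2⁻¹ := by
        rw [ENNReal.ofReal_inv_of_pos two_pos]; norm_num
      by_cases hd : d (Z ω) = X ω
      · simp [hd, Real.exp_neg, Real.exp_log, e2]
      · rw [if_pos hd, if_neg (Ne.symm hd), zero_sub, neg_add, Real.exp_add, Real.exp_neg,
          Real.exp_neg, Real.exp_log two_pos, Real.exp_log (by linarith),
          ENNReal.ofReal_mul (by positivity), e2, ENNReal.ofReal_inv_of_pos (by linarith),
          ENNReal.ofReal_natCast]
        simp)
  simp only [ENNReal.ofReal_zero, expect_const, add_zero] at key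
  refine key.trans (add_le_add le_rfl (le_of_eq ?_))
  rw [expect, expect, ← ENNReal.tsum_mul_right]
  rw [← p.expect_const (ENNReal.ofReal (Real.log 2)), expect, ← ENNReal.tsum_add]
  refine tsum_congr fun ω => ?_
  rw [mul_assoc, ← mul_add]
  congr 1
  by_cases hd : d (Z ω) = X ω
  · simp [hd]
  · simp [hd, ENNReal.ofReal_add hl2 hl]

end PMF

open PMF

/-! ### Passage between extended and real-valued entropy -/

theorem ofReal_negMulLog_toReal {A : Type*} (p : PMF A) (a : A) :
    ENNReal.ofReal (Real.negMulLog (p a).toReal) = p a * ENNReal.ofReal (p.info a) := by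
  rw [Real.negMulLog, neg_mul_comm, ENNReal.ofReal_mul ENNReal.toReal_nonneg,
    ENNReal.ofReal_toReal (p.apply_ne_top a), info]

theorem negMulLog_toReal {A : Type*} (p : PMF A) (a : A) :
    Real.negMulLog (p a).toReal = (p a * ENNReal.ofReal (p.info a)).toReal := by
  rw [← ofReal_negMulLog_toReal, ENNReal.toReal_ofReal
    (Real.negMulLog_nonneg ENNReal.toReal_nonneg (p.toReal_le_one a))]

theorem hasFiniteEntropy_iff {A : Type*} (p : PMF A) :
    HasFiniteEntropy p ↔ p.eEntropy ≠ ⊤ := by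
  constructor
  · intro h
    have := h.tsum_ofReal_ne_top
    simpa only [ofReal_negMulLog_toReal, eEntropy, expect] using this
  · intro h
    unfold HasFiniteEntropy
    simp only [negMulLog_toReal]
    exact ENNReal.summable_toReal h

theorem entropy_eq {A : Type*} (p : PMF A) : entropy p = p.eEntropy.toReal / Real.log 2 := by
  rw [entropy, tsum_div_const, eEntropy, expect, ENNReal.tsum_toReal_eq]
  · simp only [negMulLog_toReal]
  · exact fun a => ENNReal.mul_ne_top (p.apply_ne_top a) ENNReal.ofReal_ne_top

/-! ## Independent repetition -/

theorem ENNReal.tsum_pi_prod {A : Type u₁} {N : ℕ} (g : Fin N → A → ℝ≥0∞) :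
    ∑' y : Fin N → A, ∏ n, g n (y n) = ∏ n, ∑' a, g n a := by
  induction N with
  | zero => simp
  | succ N ih =>
    rw [← (Fin.consEquiv fun _ => A).tsum_eq, Fin.prod_univ_succ, ← ih, ← ENNReal.tsum_mul_right,
      ENNReal.tsum_prod' ]
    refine tsum_congr fun a => ?_
    rw [← ENNReal.tsum_mul_left]
    refine tsum_congr fun y => ?_
    simp [Fin.consEquiv, Fin.prod_univ_succ]

namespace PMF

variable {Ω : Type u₁} {A : Type u₂} {B : Type u₃}

/-- The law of `N` independent random variables with law `p`. -/
def block (p : PMF A) (N : ℕ) : PMF (Fin N → A) :=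
  ⟨fun y => ∏ n, p (y n), by
    rw [ENNReal.summable.hasSum_iff, ENNReal.tsum_pi_prod fun _ a => p a]
    simp [p.tsum_coe]⟩

theorem block_apply (p : PMF A) (N : ℕ) (y : Fin N → A) : p.block N y = ∏ n, p (y n) := rfl

theorem block_map (p : PMF A) (f : A → B) (N : ℕ) :
    (p.block N).map (fun y n => f (y n)) = (p.map f).block N := by
  classical
  ext z
  simp only [PMF.map_apply, block_apply]
  rw [← ENNReal.tsum_pi_prod fun n a => if z n = f a then p a else 0]
  refine tsum_congr fun y => ?_
  split_ifs with h
  · exact Finset.prod_congr rfl fun n _ => (if_pos (congrFun h n)).symm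
  · obtain ⟨n, hn⟩ := Function.ne_iff.1 h
    exact (Finset.prod_eq_zero (Finset.mem_univ n) (if_neg hn)).symm

theorem expect_block_apply (p : PMF A) (N : ℕ) (m : Fin N) (g : A → ℝ≥0∞) :
    (p.block N).expect (fun y => g (y m)) = p.expect g := by
  -- The weight `g` is absorbed into the `m`-th factor, so the sum factorizes and every other factor
  -- sums to `1`.
  have h1 : ∀ y : Fin N → A, p.block N y * g (y m) =
      ∏ n, p (y n) * (if n = m then g (y n) else 1) := fun y => by
    rw [Finset.prod_mul_distrib, block_apply, Finset.prod_ite_eq' Finset.univ m]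
    simp
  simp only [expect, h1]
  rw [ENNReal.tsum_pi_prod fun n a => p a * (if n = m then g a else 1),
    Finset.prod_eq_single m]
  · simp
  · intro n _ hn; simp [hn, p.tsum_coe]
  · simp

theorem expect_finsetSum {ι : Type*} (p : PMF A) (s : Finset ι) (g : ι → A → ℝ≥0∞) :
    p.expect (fun a => ∑ i ∈ s, g i a) = ∑ i ∈ s, p.expect (g i) := by
  simp only [expect, Finset.mul_sum]
  exact Summable.tsum_finsetSum fun _ _ => ENNReal.summable

/-- Self-information is additive over independent coordinates, and each coordinate has law `p`. -/
theorem eEntropy_block (p : PMF A) (N : ℕ) : (p.block N).eEntropy = N * p.eEntropy := by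
  calc (p.block N).eEntropy
      = (p.block N).expect fun y => ∑ n, ENNReal.ofReal (p.info (y n)) := by
        refine expect_congr _ fun y hy => ?_
        rw [← ENNReal.ofReal_sum_of_nonneg fun _ _ => info_nonneg _ _]
        congr 1
        rw [block_apply, Finset.prod_ne_zero_iff] at hy
        simp only [info, block_apply, ENNReal.toReal_prod]
        rw [Real.log_prod fun n hn => (toReal_pos (hy n hn)).ne', Finset.sum_neg_distrib]
    _ = N * p.eEntropy := by
        rw [expect_finsetSum]
        rw [Finset.sum_congr rfl fun n _ =>
          expect_block_apply p N n fun a => ENNReal.ofReal (p.info a)]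
        simp [eEntropy]

/-! ## Mixing with a constant -/

theorem _root_.ENNReal.tsum_option {A : Type*} (g : Option A → ℝ≥0∞) :
    ∑' o, g o = g none + ∑' a, g (some a) := by
  rw [← (Equiv.optionEquivSumPUnit.{0} A).symm.tsum_eq,
    Summable.tsum_sum ENNReal.summable ENNReal.summable, add_comm]
  simp

/-- The law of the random variable that is drawn from `p` with probability `δ` and is `none`
otherwise. -/
def mix (δ : ℝ≥0∞) (hδ : δ ≤ 1) (p : PMF A) : PMF (Option A) :=
  ⟨fun o => o.elim (1 - δ) fun a => δ * p a, by
    rw [ENNReal.summable.hasSum_iff, ENNReal.tsum_option]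
    simp [ENNReal.tsum_mul_left, p.tsum_coe, tsub_add_cancel_of_le hδ]⟩

variable {δ : ℝ≥0∞} (hδ : δ ≤ 1)

theorem mix_none (p : PMF A) : mix δ hδ p none = 1 - δ := rfl

theorem mix_some (p : PMF A) (a : A) : mix δ hδ p (some a) = δ * p a := rfl

theorem expect_mix (p : PMF A) (g : Option A → ℝ≥0∞) :
    (mix δ hδ p).expect g = (1 - δ) * g none + δ * p.expect fun a => g (some a) := by
  simp only [expect, ENNReal.tsum_option, mix_none, mix_some, mul_assoc, ENNReal.tsum_mul_left]

theorem mix_map (p : PMF A) (f : A → B) :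
    (mix δ hδ p).map (Option.map f) = mix δ hδ (p.map f) := by
  classical
  ext o
  rw [PMF.map_apply, ENNReal.tsum_option]
  cases o with
  | none => simp [mix_none]
  | some b =>
    simp only [mix_some, PMF.map_apply, ← ENNReal.tsum_mul_left]
    simp

/-- The entropy (in nats) of a binary random variable. -/
def binEEntropy (δ : ℝ≥0∞) : ℝ≥0∞ :=
  ENNReal.ofReal (Real.negMulLog (1 - δ).toReal) + ENNReal.ofReal (Real.negMulLog δ.toReal)

/-- Chain rule: `binEEntropy δ` pays for learning whether the outcome is `none`, and with
probability `δ` an outcome of `p` remains to be described. -/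
theorem eEntropy_mix (hδ0 : δ ≠ 0) (p : PMF A) :
    (mix δ hδ p).eEntropy = binEEntropy δ + δ * p.eEntropy := by
  have hδt : δ ≠ ⊤ := ne_top_of_le_ne_top ENNReal.one_ne_top hδ
  have hδr : 0 < δ.toReal := ENNReal.toReal_pos hδ0 hδt
  have hδ1 : δ.toReal ≤ 1 := by simpa using ENNReal.toReal_mono ENNReal.one_ne_top hδ
  have h1 : p.expect (fun a => ENNReal.ofReal ((mix δ hδ p).info (some a))) =
      ENNReal.ofReal (-Real.log δ.toReal) + p.eEntropy := by
    rw [eEntropy, ← p.expect_const (ENNReal.ofReal (-Real.log δ.toReal)), ← expect_add]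
    refine expect_congr _ fun a ha => ?_
    rw [← ENNReal.ofReal_add
      (neg_nonneg.2 (Real.log_nonpos hδr.le hδ1)) (info_nonneg _ _)]
    congr 1
    rw [info, info, mix_some, ENNReal.toReal_mul, Real.log_mul hδr.ne' (toReal_pos ha).ne', neg_add]
  rw [eEntropy, expect_mix, h1, mul_add, ← add_assoc, binEEntropy]
  congr 2
  · rw [← mix_none hδ p, ofReal_negMulLog_toReal]
  · rw [Real.negMulLog, neg_mul_comm, ENNReal.ofReal_mul hδr.le, ENNReal.ofReal_toReal hδt]

end PMF

/-! ## Families of random variables -/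

section Family

variable {Ω : Type u₁} {Z : Type u₂} {T : Z → Type u₃}

/-- The joint entropy (in nats) of the subfamily with indices in `α`. -/
def familyEntropy (P : PMF Ω) (F : ∀ z, Ω → T z) (α : Set Z) : ℝ≥0∞ :=
  (P.map fun ω (z : α) => F z ω).eEntropy

variable (P : PMF Ω) (F : ∀ z, Ω → T z)

theorem familyEntropy_mono {α β : Set Z} (h : β ⊆ α) :
    familyEntropy P F β ≤ familyEntropy P F α :=
  P.eEntropy_map_le_of_determined _ _ fun _ _ _ _ he =>
    funext fun z => congrFun he (⟨z, h z.2⟩ : α)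

theorem familyEntropy_le (α : Set Z) : familyEntropy P F α ≤ P.eEntropy := P.eEntropy_map_le _

theorem familyEntropy_empty : familyEntropy P F ∅ = 0 := eEntropy_of_subsingleton _

theorem familyEntropy_submodular (α β : Set Z) :
    familyEntropy P F (α ∩ β) + familyEntropy P F (α ∪ β) ≤
      familyEntropy P F α + familyEntropy P F β := by
  have h := P.eEntropy_submodular (fun ω (z : α) => F z ω) (fun ω (z : β) => F z ω)
    (fun x (z : ↥(α ∩ β)) => x ⟨z, z.2.1⟩) (fun x (z : ↥(α ∩ β)) => x ⟨z, z.2.2⟩) fun _ => rfl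
  rw [add_comm]
  refine le_trans (add_le_add ?_ le_rfl) h
  refine P.eEntropy_map_le_of_determined _ _ fun ω ω' _ _ he => funext fun z => ?_
  rcases z.2 with hz | hz
  · exact congrFun (congrArg Prod.snd he) ⟨z, hz⟩
  · exact congrFun (congrArg Prod.fst he) ⟨z, hz⟩

theorem isPolymatroid_familyEntropy (hP : P.eEntropy ≠ ⊤) :
    IsPolymatroid fun α => (familyEntropy P F α).toReal / Real.log 2 := by
  have hl : 0 < Real.log 2 := Real.log_pos one_lt_two
  have ht : ∀ α, familyEntropy P F α ≠ ⊤ := fun α =>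
    ne_top_of_le_ne_top hP (familyEntropy_le P F α)
  refine ⟨by simp [familyEntropy_empty], fun α => by positivity, fun α β h => ?_, fun α β => ?_⟩
  · exact div_le_div_of_nonneg_right (ENNReal.toReal_mono (ht α) (familyEntropy_mono P F h)) hl.le
  · rw [← add_div, ← add_div, ← ENNReal.toReal_add (ht _) (ht _), ← ENNReal.toReal_add (ht _) (ht _)]
    exact div_le_div_of_nonneg_right (ENNReal.toReal_mono (ENNReal.add_ne_top.2 ⟨ht _, ht _⟩)
      (familyEntropy_submodular P F α β)) hl.le

theorem entropyFunction_eq {X : Z → Type u₃} (p : PMF (∀ z, X z)) :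
    entropyFunction p = fun α => (familyEntropy p (fun z x => x z) α).toReal / Real.log 2 :=
  funext fun _ => entropy_eq _

theorem entropicFunctions_subset_polymatroids (Z : Type u₂) :
    entropicFunctions Z ⊆ polymatroids Z := by
  rintro h ⟨X, p, hp, rfl⟩
  rw [entropyFunction_eq]
  exact isPolymatroid_familyEntropy _ _ ((hasFiniteEntropy_iff p).1 hp)

theorem isClosed_polymatroids (Z : Type u₂) : IsClosed (polymatroids Z) := by
  have : polymatroids Z = {h | h ∅ = 0} ∩ (⋂ α, {h | 0 ≤ h α}) ∩
      (⋂ α, ⋂ β, ⋂ _ : β ⊆ α, {h | h β ≤ h α}) ∩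
      ⋂ α, ⋂ β, {h | h (α ∩ β) + h (α ∪ β) ≤ h α + h β} := by
    ext h
    simp only [polymatroids, Set.mem_inter_iff, Set.mem_iInter, Set.mem_ofPred_eq]
    exact ⟨fun ⟨a, b, c, d⟩ => ⟨⟨⟨a, b⟩, c⟩, d⟩, fun ⟨⟨⟨a, b⟩, c⟩, d⟩ => ⟨a, b, c, d⟩⟩
  rw [this]
  refine (((isClosed_eq (continuous_apply _) continuous_const).inter
    (isClosed_iInter fun α => isClosed_le continuous_const (continuous_apply _))).inter
    (isClosed_iInter fun α => isClosed_iInter fun β => isClosed_iInter fun _ =>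
      isClosed_le (continuous_apply _) (continuous_apply _))).inter
    (isClosed_iInter fun α => isClosed_iInter fun β => isClosed_le ?_ ?_)
  · exact (continuous_apply _).add (continuous_apply _)
  · exact (continuous_apply _).add (continuous_apply _)

theorem almostEntropicFunctions_subset_polymatroids (Z : Type u₂) :
    almostEntropicFunctions Z ⊆ polymatroids Z :=
  closure_minimal (entropicFunctions_subset_polymatroids Z) (isClosed_polymatroids Z)

/-- The entropy function of every family of discrete random variables is entropic: the alphabets
may lie in any universe. -/
theorem familyEntropy_mem_entropicFunctions (hP : P.eEntropy ≠ ⊤) :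
    (fun α => (familyEntropy P F α).toReal / Real.log 2) ∈ entropicFunctions Z := by
  -- A discrete law has countable support, so each alphabet can be coded in `ℕ`, injectively on the
  -- values of positive probability; this changes no entropy.
  have hc : ∀ z, ∃ e : T z → ℕ, Set.InjOn e (F z '' P.support) := fun z =>
    Set.countable_iff_exists_injOn.1 (P.support_countable.image (F z))
  choose e he using hc
  refine ⟨fun _ => ℕ, P.map fun ω z => e z (F z ω), ?_, ?_⟩
  · rw [hasFiniteEntropy_iff]
    exact ne_top_of_le_ne_top hP (P.eEntropy_map_le _)
  · rw [entropyFunction_eq]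
    funext α
    congr 2
    rw [familyEntropy, familyEntropy, PMF.map_comp]
    refine P.eEntropy_map_eq_of_determined _ _ fun ω ω' hω hω' => ?_
    constructor
    · intro h
      funext z
      exact he z ⟨ω', hω', rfl⟩ ⟨ω, hω, rfl⟩ (congrFun h z)
    · intro h
      funext z
      exact congrArg (e z) (congrFun h z)

/-- Any single member of the mixed family reveals whether the outcome is `none`, so a nonempty
subfamily carries the same information as the mixture of the corresponding tuple. For `α = ∅` the
left side is `0` and the binary entropy term would be spurious. -/
theorem familyEntropy_mix {δ : ℝ≥0∞} (hδ : δ ≤ 1) (hδ0 : δ ≠ 0) {α : Set Z} (hα : α.Nonempty) :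
    familyEntropy (mix δ hδ P) (fun z => Option.map (F z)) α =
      binEEntropy δ + δ * familyEntropy P F α := by
  obtain ⟨z₀, hz₀⟩ := hα
  rw [familyEntropy, familyEntropy, ← eEntropy_mix hδ hδ0, ← mix_map]
  refine eEntropy_map_eq_of_determined _ _ _ fun o o' _ _ => ?_
  rcases o with _ | ω <;> rcases o' with _ | ω'
  · simp
  · simp [funext_iff]
    exact ⟨z₀, hz₀⟩
  · simp [funext_iff]
    exact ⟨z₀, hz₀⟩
  · simp [funext_iff]

end Family

/-! ## The random variables of a network code -/

section CodeVariables

variable {V E S L : Type*} {net : Network V E S} {Y : S → Type u₁} {K : L → Type u₂} {N : ℕ}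

theorem jointLaw_map_fst (p : PMF (∀ s, Y s)) (κ : (∀ s, Y s) → PMF (∀ i, K i)) :
    (jointLaw p κ).map Prod.fst = p := by
  rw [jointLaw, PMF.map_bind]
  conv_rhs => rw [← PMF.bind_pure p]
  congr 1
  funext y
  rw [PMF.map_comp]
  exact PMF.map_const _ _

theorem jointEntropy_empty (p : PMF (∀ s, Y s)) (κ : (∀ s, Y s) → PMF (∀ i, K i)) (α : Set S) :
    jointEntropy p κ α ∅ = entropyFunction p α := by
  rw [jointEntropy, entropyFunction, entropy_eq, entropy_eq]
  conv_rhs => rw [← jointLaw_map_fst p κ, PMF.map_comp]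
  congr 2
  refine eEntropy_map_eq_of_determined _ _ _ fun x x' _ _ => ?_
  rw [Prod.mk.injEq]
  exact ⟨fun h => ⟨h, Subsingleton.elim _ _⟩, And.left⟩

/-- The alphabets of the blocks of source symbols, of the messages and of the blocks of auxiliary
symbols. -/
def CodeAlphabet (c : NetworkCode net Y N) (K : L → Type u₂) : (S ⊕ E) ⊕ L → Type (max u₁ u₂)
  | .inl (.inl s) => ULift.{u₂} (Fin N → Y s)
  | .inl (.inr e) => ULift (Fin (c.size e))
  | .inr i => ULift.{u₁} (Fin N → K i)

variable [Finite E]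

/-- The blocks of source symbols, the messages and the blocks of auxiliary symbols as functions of
the outcome. -/
def codeVariable (c : NetworkCode net Y N) (K : L → Type u₂) :
    ∀ z : (S ⊕ E) ⊕ L, (Fin N → (∀ s, Y s) × (∀ i, K i)) → CodeAlphabet c K z
  | .inl (.inl s), ω => ⟨fun n => (ω n).1 s⟩
  | .inl (.inr e), ω => ⟨c.message (fun n => (ω n).1) e⟩
  | .inr i, ω => ⟨fun n => (ω n).2 i⟩

variable (c : NetworkCode net Y N)

/-- The joint entropy (in nats) of source blocks, messages and auxiliary blocks. -/
def codeEntropy (J : PMF ((∀ s, Y s) × (∀ i, K i))) (c : NetworkCode net Y N)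
    (γ : Set ((S ⊕ E) ⊕ L)) : ℝ≥0∞ :=
  familyEntropy (J.block N) (codeVariable c K) γ

variable (J : PMF ((∀ s, Y s) × (∀ i, K i)))

theorem codeEntropy_le (γ : Set ((S ⊕ E) ⊕ L)) : codeEntropy J c γ ≤ N * J.eEntropy := by
  rw [← eEntropy_block]
  exact familyEntropy_le _ _ _

/-- Source and auxiliary blocks are computed letter by letter, so regrouping coordinates gives again
a block of i.i.d. letters. Equality at every block length makes the limit meet the prescribed
entropies exactly. -/
theorem codeEntropy_sources (α : Set S) (β : Set L) :
    codeEntropy J c (Sum.inl '' (Sum.inl '' α) ∪ Sum.inr '' β) =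
      N * (J.map fun x => (α.domRestrict x.1, β.domRestrict x.2)).eEntropy := by
  rw [← eEntropy_block, ← block_map]
  refine eEntropy_map_eq_of_determined _ _ _ fun ω ω' _ _ => ?_
  constructor
  · intro h
    funext ⟨z, hz⟩
    rcases hz with ⟨_, ⟨s, hs, rfl⟩, rfl⟩ | ⟨i, hi, rfl⟩
    · exact congrArg ULift.up (funext fun n => congrFun (congrArg Prod.fst (congrFun h n)) ⟨s, hs⟩)
    · exact congrArg ULift.up (funext fun n => congrFun (congrArg Prod.snd (congrFun h n)) ⟨i, hi⟩)
  · intro h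
    funext n
    refine Prod.ext (funext fun s => ?_) (funext fun i => ?_)
    · exact congrFun (congrArg ULift.down (congrFun h ⟨_, .inl ⟨_, ⟨s.1, s.2, rfl⟩, rfl⟩⟩)) n
    · exact congrFun (congrArg ULift.down (congrFun h ⟨_, .inr ⟨i.1, i.2, rfl⟩⟩)) n

/-- Unpacks agreement of all variables entering `u` into agreement of the arguments that encoders
and decoders at `u` receive. -/
theorem codeVariable_eq_of_incoming {u : V} {ω ω' : Fin N → (∀ s, Y s) × (∀ i, K i)}
    (h : (fun z : ↥(Sum.inl '' net.incoming u : Set ((S ⊕ E) ⊕ L)) => codeVariable c K z ω') =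
      fun z : ↥(Sum.inl '' net.incoming u : Set ((S ⊕ E) ⊕ L)) => codeVariable c K z ω) :
    (∀ s, u ∈ net.avail s → ∀ n, (ω' n).1 s = (ω n).1 s) ∧
      ∀ f, net.head f = u →
        c.message (fun n => (ω' n).1) f = c.message (fun n => (ω n).1) f :=
  ⟨fun s hs n => congrFun
    (congrArg ULift.down (congrFun h ⟨.inl (.inl s), ⟨_, .inl ⟨s, hs, rfl⟩, rfl⟩⟩)) n,
  fun f hf => congrArg ULift.down (congrFun h ⟨.inl (.inr f), ⟨_, .inr ⟨f, hf, rfl⟩, rfl⟩⟩)⟩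

theorem codeEntropy_encode (e : E) :
    codeEntropy J c (Sum.inl '' ({Sum.inr e} ∪ net.incoming (net.tail e))) =
      codeEntropy J c (Sum.inl '' net.incoming (net.tail e)) := by
  refine le_antisymm (eEntropy_map_le_of_determined _ _ _ fun ω ω' _ _ h => ?_)
    (familyEntropy_mono _ _ (Set.image_mono Set.subset_union_right))
  funext ⟨z, hz⟩
  rcases hz with ⟨z, rfl | hz, rfl⟩
  · obtain ⟨h1, h2⟩ := codeVariable_eq_of_incoming c h
    refine congrArg ULift.up ?_
    rw [c.message_eq, c.message_eq]
    congr 1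
    · funext s n; exact h1 s s.2 n
    · funext f; exact h2 f f.2
  · exact congrFun h ⟨_, z, hz, rfl⟩

theorem codeEntropy_message_le (e : E) :
    codeEntropy J c (Sum.inl '' {Sum.inr e}) ≤ ENNReal.ofReal (Real.log (c.size e)) := by
  have h := eEntropy_le_log_card ((J.block N).map fun ω => c.message (fun n => (ω n).1) e)
  rw [Nat.card_fin] at h
  refine le_trans (eEntropy_map_le_of_determined _ _ _ fun ω ω' _ _ h => ?_) h
  funext ⟨z, hz⟩
  rcases hz with ⟨z, rfl, rfl⟩
  exact congrArg ULift.up h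

theorem expect_indicator_decoded (p : PMF (∀ s, Y s)) (hJ : J.map Prod.fst = p) {s : S} {u : V}
    (hu : u ∈ net.demand s) :
    (J.block N).expect ({ω | c.decoded s u hu (fun n => (ω n).1) ≠ fun n => (ω n).1 s}.indicator 1)
      = c.errorProb p s u hu := by
  have h1 : c.errorProb p s u hu =
      (p.block N).expect ({y | c.decoded s u hu y ≠ fun n => y n s}.indicator 1) := by
    refine tsum_congr fun y => ?_
    by_cases hy : c.decoded s u hu y = fun n => y n s <;> simp [hy, block_apply]
  rw [h1, ← hJ, ← block_map, expect_map]
  rfl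

theorem errorProb_le_one (p : PMF (∀ s, Y s)) {s : S} {u : V} (hu : u ∈ net.demand s) :
    c.errorProb p s u hu ≤ 1 := by
  rw [← (p.block N).tsum_coe]
  exact ENNReal.tsum_le_tsum fun y => Set.indicator_le_self _ _ _

/-- Fano's inequality with the decoder at `u` as the guess of the source block. The block has
`Nat.card (Y s) ^ N` possible values, so the excess is `o(N)` once the error probability tends to
`0`. -/
theorem codeEntropy_decode [∀ s, Finite (Y s)] (p : PMF (∀ s, Y s)) (hJ : J.map Prod.fst = p)
    {s : S} {u : V} (hu : u ∈ net.demand s) :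
    codeEntropy J c (Sum.inl '' ({Sum.inl s} ∪ net.incoming u)) ≤
      codeEntropy J c (Sum.inl '' net.incoming u) + (ENNReal.ofReal (Real.log 2) +
        c.errorProb p s u hu * ENNReal.ofReal (N * Real.log (Nat.card (Y s)))) := by
  have h := (J.block N).eEntropy_fano (fun ω n => (ω n).1 s)
    (fun ω (z : ↥(Sum.inl '' net.incoming u : Set ((S ⊕ E) ⊕ L))) => codeVariable c K z ω)
    (fun x => c.decode s u hu
      (fun s' => ULift.down (x ⟨.inl (.inl s'.1), ⟨_, .inl ⟨s'.1, s'.2, rfl⟩, rfl⟩⟩))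
      fun f => ULift.down (x ⟨.inl (.inr f.1), ⟨_, .inr ⟨f.1, f.2, rfl⟩, rfl⟩⟩))
  rw [Nat.card_fun, Nat.card_fin, Nat.cast_pow, Real.log_pow] at h
  rw [← expect_indicator_decoded c J p hJ hu]
  refine le_trans (eEntropy_map_le_of_determined _ _ _ fun ω ω' _ _ h => ?_) h
  funext ⟨z, hz⟩
  rcases hz with ⟨z, rfl | hz, rfl⟩
  · exact congrArg ULift.up (congrArg Prod.fst h)
  · exact congrFun (congrArg Prod.snd h) ⟨_, z, hz, rfl⟩

end CodeVariables

/-! ## Limits of normalized entropy functions -/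

theorem tendsto_binEEntropy :
    Tendsto (fun n : ℕ => (binEEntropy (n + 1 : ℝ≥0∞)⁻¹).toReal) atTop (𝓝 0) := by
  have h0 : Tendsto (fun n : ℕ => ((n : ℝ) + 1)⁻¹) atTop (𝓝 0) := by
    simpa using tendsto_one_div_add_atTop_nhds_zero_nat (𝕜 := ℝ)
  have h1 : Tendsto (fun n : ℕ => 1 - ((n : ℝ) + 1)⁻¹) atTop (𝓝 1) := by
    simpa using h0.const_sub 1
  have h2 := ((Real.continuous_negMulLog.tendsto _).comp h1).add
    ((Real.continuous_negMulLog.tendsto _).comp h0)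
  rw [Real.negMulLog_one, Real.negMulLog_zero, add_zero] at h2
  refine h2.congr fun n => ?_
  have hi : ((n : ℝ) + 1)⁻¹ ≤ 1 := inv_le_one_of_one_le₀ (by linarith [n.cast_nonneg (α := ℝ)])
  have hi0 : 0 ≤ ((n : ℝ) + 1)⁻¹ := by positivity
  have e1 : ((n + 1 : ℝ≥0∞)⁻¹).toReal = ((n : ℝ) + 1)⁻¹ := by
    rw [ENNReal.toReal_inv, ENNReal.toReal_add (by simp) (by simp)]
    simp
  have hle : (n + 1 : ℝ≥0∞)⁻¹ ≤ 1 := by simp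
  rw [binEEntropy, ENNReal.toReal_sub_of_le hle ENNReal.one_ne_top, e1, ENNReal.toReal_one,
    ENNReal.toReal_add ENNReal.ofReal_ne_top ENNReal.ofReal_ne_top,
    ENNReal.toReal_ofReal (Real.negMulLog_nonneg (by linarith) (by linarith)),
    ENNReal.toReal_ofReal (Real.negMulLog_nonneg hi0 hi)]
  rfl

/-- Entropy functions scaled by factors `1 / (n + 1)` have, if they are bounded, an almost entropic
limit point. -/
theorem exists_tendsto_scaled_familyEntropy {Z : Type u₁} {Ω : ℕ → Type u₂} {T : ℕ → Z → Type u₃}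
    (P : ∀ n, PMF (Ω n)) (F : ∀ n z, Ω n → T n z) (hP : ∀ n, (P n).eEntropy ≠ ⊤) (B : ℝ)
    (hB : ∀ n α, (familyEntropy (P n) (F n) α).toReal / Real.log 2 / (n + 1) ≤ B) :
    ∃ h ∈ almostEntropicFunctions Z, ∀ α,
      Tendsto (fun n => (familyEntropy (P n) (F n) α).toReal / Real.log 2 / (n + 1))
        (hyperfilter ℕ) (𝓝 (h α)) := by
  have hl : 0 < Real.log 2 := Real.log_pos one_lt_two
  set r : ℕ → Set Z → ℝ := fun n α =>
    (familyEntropy (P n) (F n) α).toReal / Real.log 2 / (n + 1) with hr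
  have hcomp : IsCompact (Set.univ.pi fun _ : Set Z => Set.Icc (0 : ℝ) B) :=
    isCompact_univ_pi fun _ => isCompact_Icc
  -- By Tychonoff the box is compact. A limit along a nonprincipal ultrafilter converges at every
  -- `α` at once and, since `hyperfilter ℕ ≤ atTop`, agrees with every ordinary limit.
  obtain ⟨h, -, hh⟩ := isCompact_iff_ultrafilter_le_nhds.1 hcomp ((hyperfilter ℕ).map r) (by
    rw [le_principal_iff]
    exact Ultrafilter.mem_map.2 (Filter.univ_mem' fun n => fun α _ => ⟨by positivity, hB n α⟩))
  have hrh : ∀ α, Tendsto (fun n => r n α) (hyperfilter ℕ) (𝓝 (h α)) := tendsto_pi_nhds.1 hh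
  refine ⟨h, ?_, hrh⟩
  have hδ : ∀ n : ℕ, (n + 1 : ℝ≥0∞)⁻¹ ≤ 1 := fun n => by simp
  have hδ0 : ∀ n : ℕ, (n + 1 : ℝ≥0∞)⁻¹ ≠ 0 := fun n => by simp
  -- Entropic approximants: mixing with `δ = 1 / (n + 1)` scales entropies by `δ`, up to the binary
  -- entropy of `δ`.
  let g : ℕ → Set Z → ℝ := fun n α =>
    (familyEntropy (mix _ (hδ n) (P n)) (fun z => Option.map (F n z)) α).toReal / Real.log 2
  have hbt : ∀ n : ℕ, binEEntropy (n + 1 : ℝ≥0∞)⁻¹ ≠ ⊤ := fun n =>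
    ENNReal.add_ne_top.2 ⟨ENNReal.ofReal_ne_top, ENNReal.ofReal_ne_top⟩
  have hg : ∀ n, g n ∈ entropicFunctions Z := fun n => by
    refine familyEntropy_mem_entropicFunctions _ _ ?_
    rw [eEntropy_mix (hδ n) (hδ0 n)]
    exact ENNReal.add_ne_top.2
      ⟨hbt n, ENNReal.mul_ne_top (ne_top_of_le_ne_top ENNReal.one_ne_top (hδ n)) (hP n)⟩
  have hgh : Tendsto g (hyperfilter ℕ) (𝓝 h) := by
    refine tendsto_pi_nhds.2 fun α => ?_
    rcases α.eq_empty_or_nonempty with rfl | hα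
    · refine (hrh ∅).congr fun n => ?_
      simp [hr, g, familyEntropy_empty]
    · have hb := (tendsto_binEEntropy.mono_left
        (Nat.hyperfilter_le_atTop)).div_const (Real.log 2)
      have := hb.add (hrh α)
      rw [zero_div, zero_add] at this
      refine this.congr fun n => ?_
      simp only [g, hr]
      rw [familyEntropy_mix _ _ (hδ n) (hδ0 n) hα, ENNReal.toReal_add (hbt n)
        (ENNReal.mul_ne_top (ne_top_of_le_ne_top ENNReal.one_ne_top (hδ n))
          (ne_top_of_le_ne_top (hP n) (familyEntropy_le _ _ _))), ENNReal.toReal_mul, add_div,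
        ENNReal.toReal_inv, ENNReal.toReal_add (by simp) (by simp)]
      simp only [ENNReal.toReal_natCast, ENNReal.toReal_one]
      ring
  exact mem_closure_of_tendsto hgh (Eventually.of_forall hg)

/-! ## Inclusions of the regions -/

section Inclusions

variable {V E S L : Type*} (net : Network V E S) {Y : S → Type*} (p : PMF (∀ s, Y s))
  {K : L → Type*} (κ : (∀ s, Y s) → PMF (∀ i, K i))

theorem improvedOuterRegion_mono {Δ Δ' : Set (Set ((S ⊕ E) ⊕ L) → ℝ)} (h : Δ ⊆ Δ') :
    improvedOuterRegion net p κ Δ ⊆ improvedOuterRegion net p κ Δ' :=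
  fun _ ⟨g, hg, hg'⟩ => ⟨g, h hg, hg'⟩

theorem outerRegion_mono {Δ Δ' : Set (Set (S ⊕ E) → ℝ)} (h : Δ ⊆ Δ') :
    outerRegion net p Δ ⊆ outerRegion net p Δ' :=
  fun _ ⟨g, hg, hg'⟩ => ⟨g, h hg, hg'⟩

theorem improvedOuterRegion_subset_outerRegion {Δ : Set (Set ((S ⊕ E) ⊕ L) → ℝ)}
    {Δ' : Set (Set (S ⊕ E) → ℝ)} (h : ∀ g ∈ Δ, (fun γ => g (Sum.inl '' γ)) ∈ Δ') :
    improvedOuterRegion net p κ Δ ⊆ outerRegion net p Δ' := by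
  rintro C ⟨g, hg, hs, hC⟩
  refine ⟨_, h g hg, fun α => ?_, hC⟩
  -- The source constraint is the case `β = ∅` of the joint one.
  rw [← jointEntropy_empty p κ, ← hs, Set.image_empty, Set.union_empty]

theorem restrict_mem_polymatroids {Z : Type u₁} {L : Type u₂} {g : Set (Z ⊕ L) → ℝ}
    (hg : g ∈ polymatroids (Z ⊕ L)) : (fun γ => g (Sum.inl '' γ)) ∈ polymatroids Z where
  empty := by rw [Set.image_empty]; exact hg.empty
  nonneg α := hg.nonneg _
  mono α β h := hg.mono _ _ (Set.image_mono h)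
  submodular α β := by
    rw [Set.image_inter Sum.inl_injective, Set.image_union]
    exact hg.submodular _ _

theorem restrict_mem_entropicFunctions {Z : Type u₁} {L : Type u₂} {g : Set (Z ⊕ L) → ℝ}
    (hg : g ∈ entropicFunctions (Z ⊕ L)) : (fun γ => g (Sum.inl '' γ)) ∈ entropicFunctions Z := by
  obtain ⟨X, p, hp, rfl⟩ := hg
  have h := familyEntropy_mem_entropicFunctions p (fun (z : Z) x => x (.inl z))
    ((hasFiniteEntropy_iff p).1 hp)
  convert h using 2 with γ
  rw [entropyFunction_eq]
  change (familyEntropy p (fun z x => x z) (Sum.inl '' γ)).toReal / Real.log 2 = _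
  congr 2
  refine eEntropy_map_eq_of_determined _ _ _ fun x x' _ _ => ?_
  constructor
  · intro h
    funext ⟨z, hz⟩
    rcases hz with ⟨z, hz, rfl⟩
    exact congrFun h ⟨z, hz⟩
  · intro h
    funext z
    exact congrFun h ⟨_, z.1, z.2, rfl⟩

/-- Restriction is continuous for pointwise convergence, so it carries the closure into the closure.
-/
theorem restrict_mem_almostEntropicFunctions {Z : Type u₁} {L : Type u₂} {g : Set (Z ⊕ L) → ℝ}
    (hg : g ∈ almostEntropicFunctions (Z ⊕ L)) :
    (fun γ => g (Sum.inl '' γ)) ∈ almostEntropicFunctions Z :=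
  map_mem_closure (f := fun (g : Set (Z ⊕ L) → ℝ) (γ : Set Z) => g (Sum.inl '' γ))
    (continuous_pi fun _ => continuous_apply _) hg fun _ h => restrict_mem_entropicFunctions h

theorem achievableRegion_subset_improvedOuterRegion [Finite E] [∀ s, Finite (Y s)]
    (hK : HasFiniteEntropy (jointLaw p κ)) :
    achievableRegion net p ⊆
      improvedOuterRegion net p κ (almostEntropicFunctions ((S ⊕ E) ⊕ L)) := by
  rintro C ⟨c, hC, hdec⟩
  have hl : 0 < Real.log 2 := Real.log_pos one_lt_two
  set J := jointLaw p κ with hJ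
  have hJt : J.eEntropy ≠ ⊤ := (hasFiniteEntropy_iff J).1 hK
  have hHt : ∀ n γ, codeEntropy J (c n) γ ≠ ⊤ := fun n γ =>
    ne_top_of_le_ne_top (ENNReal.mul_ne_top (ENNReal.natCast_ne_top n) hJt) (codeEntropy_le _ _ _)
  have hn : ∀ n : ℕ, (0 : ℝ) < n + 1 := fun n => by positivity
  have hscale : ∀ (n : ℕ) (x : ℝ≥0∞),
      (((n + 1 : ℕ) : ℝ≥0∞) * x).toReal / Real.log 2 / (n + 1) = x.toReal / Real.log 2 := by
    intro n x
    rw [ENNReal.toReal_mul, ENNReal.toReal_natCast, Nat.cast_add_one]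
    field_simp [(hn n).ne']
  -- Block lengths `n + 1` rather than `n` avoid dividing by zero. The uniform bound is the joint
  -- entropy of one letter of sources and auxiliaries, of which all code variables are functions.
  obtain ⟨h, hh, hlim⟩ := exists_tendsto_scaled_familyEntropy
    (fun n => J.block (n + 1)) (fun n => codeVariable (c (n + 1)) K)
    (fun n => by
      rw [eEntropy_block]
      exact ENNReal.mul_ne_top (ENNReal.natCast_ne_top _) hJt)
    (J.eEntropy.toReal / Real.log 2) (fun n α => by
      rw [← hscale n J.eEntropy]
      have := ENNReal.toReal_mono (ENNReal.mul_ne_top (ENNReal.natCast_ne_top (n + 1)) hJt)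
        (codeEntropy_le (c (n + 1)) J α)
      exact div_le_div_of_nonneg_right (div_le_div_of_nonneg_right this hl.le) (hn n).le)
  change ∀ α, Tendsto (fun n : ℕ => (codeEntropy J (c (n + 1)) α).toReal / Real.log 2 / (n + 1))
    (hyperfilter ℕ) (𝓝 (h α)) at hlim
  have hle : (hyperfilter ℕ : Filter ℕ) ≤ atTop := Nat.hyperfilter_le_atTop
  refine ⟨h, hh, fun α β => ?_, ?_, ?_, ?_⟩
  · refine tendsto_nhds_unique (hlim _) (tendsto_const_nhds.congr fun n => ?_)
    rw [codeEntropy_sources, hscale, jointEntropy, entropy_eq]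
  · intro e
    rw [condVal, sub_eq_zero]
    refine tendsto_nhds_unique (hlim _) ((hlim _).congr fun n => ?_)
    rw [codeEntropy_encode]
  · intro s u hu
    rw [condVal]
    refine tendsto_nhds_unique ((hlim _).sub (hlim _)) ?_
    have herr : Tendsto (fun n : ℕ => ((c (n + 1)).errorProb p s u hu).toReal) atTop (𝓝 0) := by
      have := (ENNReal.tendsto_toReal ENNReal.zero_ne_top).comp
        ((hdec s u hu).comp (tendsto_add_atTop_nat 1))
      exact this
    -- This is the Fano excess divided by `(n + 1) * log 2`. The conditional entropy is squeezed
    -- between `0`, by monotonicity, and this bound.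
    have hbound : Tendsto (fun n : ℕ => 1 / ((n : ℝ) + 1) +
        ((c (n + 1)).errorProb p s u hu).toReal * (Real.log (Nat.card (Y s)) / Real.log 2))
        atTop (𝓝 0) := by
      simpa using tendsto_one_div_add_atTop_nhds_zero_nat.add (herr.mul_const _)
    refine tendsto_of_tendsto_of_tendsto_of_le_of_le tendsto_const_nhds (hbound.mono_left hle)
      (fun n => ?_) fun n => ?_
    · have := ENNReal.toReal_mono (hHt (n + 1) _) (familyEntropy_mono (J.block (n + 1))
        (codeVariable (c (n + 1)) K) (Set.image_mono (f := Sum.inl)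
          (Set.subset_union_right (s := {Sum.inl s}) (t := net.incoming u))))
      exact sub_nonneg.2
        (div_le_div_of_nonneg_right (div_le_div_of_nonneg_right this hl.le) (hn n).le)
    · have hlY : 0 ≤ Real.log (Nat.card (Y s)) := Real.log_natCast_nonneg _
      have het : (c (n + 1)).errorProb p s u hu ≠ ⊤ :=
        ne_top_of_le_ne_top ENNReal.one_ne_top (errorProb_le_one _ _ _)
      have hx : (c (n + 1)).errorProb p s u hu *
          ENNReal.ofReal (((n + 1 : ℕ) : ℝ) * Real.log (Nat.card (Y s))) ≠ ⊤ :=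
        ENNReal.mul_ne_top het ENNReal.ofReal_ne_top
      have hy := ENNReal.add_ne_top.2 ⟨ENNReal.ofReal_ne_top (r := Real.log 2), hx⟩
      have := ENNReal.toReal_mono (ENNReal.add_ne_top.2 ⟨hHt (n + 1) _, hy⟩)
        (codeEntropy_decode (c (n + 1)) J p (jointLaw_map_fst p κ) hu)
      rw [ENNReal.toReal_add (hHt _ _) hy, ENNReal.toReal_add ENNReal.ofReal_ne_top hx,
        ENNReal.toReal_mul, ENNReal.toReal_ofReal hl.le, ENNReal.toReal_ofReal (by positivity),
        Nat.cast_add_one] at this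
      rw [← sub_div, ← sub_div, div_div, div_le_iff₀ (mul_pos hl (hn n))]
      have e : (1 / ((n : ℝ) + 1) + ((c (n + 1)).errorProb p s u hu).toReal *
          (Real.log (Nat.card (Y s)) / Real.log 2)) * (Real.log 2 * (n + 1)) =
          Real.log 2 + ((c (n + 1)).errorProb p s u hu).toReal *
            ((n + 1) * Real.log (Nat.card (Y s))) := by
        field_simp [(hn n).ne']
      rw [e]
      linarith
  · intro e
    obtain ⟨l, hlC, hl'⟩ := hC e
    -- The normalized message entropy is at most the code rate, which tends to `l ≤ C e`.
    refine le_trans (le_of_tendsto_of_tendsto (hlim _)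
      ((hl'.comp (tendsto_add_atTop_nat 1)).mono_left hle) (Eventually.of_forall fun n => ?_)) hlC
    have := ENNReal.toReal_mono ENNReal.ofReal_ne_top (codeEntropy_message_le (c (n + 1)) J e)
    rw [ENNReal.toReal_ofReal (Real.log_natCast_nonneg _)] at this
    simp only [Function.comp, Real.logb, Nat.cast_add_one]
    exact div_le_div_of_nonneg_right (div_le_div_of_nonneg_right this hl.le) (hn n).le

end Inclusions

end

theorem theorem2 {V E S L : Type*} [Finite E] [Finite S] [Finite L] (net : Network V E S)
    {Y : S → Type*} [∀ s, Finite (Y s)] (p : PMF (∀ s, Y s))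
    {K : L → Type*} (κ : (∀ s, Y s) → PMF (∀ i, K i)) (hK : HasFiniteEntropy (jointLaw p κ)) :
    (achievableRegion net p ⊆ improvedOuterRegion net p κ (almostEntropicFunctions ((S ⊕ E) ⊕ L)) ∧
      improvedOuterRegion net p κ (almostEntropicFunctions ((S ⊕ E) ⊕ L)) ⊆
        outerRegion net p (almostEntropicFunctions (S ⊕ E)) ∧
      outerRegion net p (almostEntropicFunctions (S ⊕ E)) ⊆
        outerRegion net p (polymatroids (S ⊕ E))) ∧
    (achievableRegion net p ⊆ improvedOuterRegion net p κ (polymatroids ((S ⊕ E) ⊕ L)) ∧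
      improvedOuterRegion net p κ (polymatroids ((S ⊕ E) ⊕ L)) ⊆
        outerRegion net p (polymatroids (S ⊕ E))) :=
  ⟨⟨achievableRegion_subset_improvedOuterRegion net p κ hK,
      improvedOuterRegion_subset_outerRegion net p κ
        fun _ => restrict_mem_almostEntropicFunctions,
      outerRegion_mono net p (almostEntropicFunctions_subset_polymatroids _)⟩,
    (achievableRegion_subset_improvedOuterRegion net p κ hK).trans
      (improvedOuterRegion_mono net p κ (almostEntropicFunctions_subset_polymatroids _)),
    improvedOuterRegion_subset_outerRegion net p κ fun _ => restrict_mem_polymatroids⟩
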